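/- All graphs are finite and simple. An anti-Kekulé set of a connected graph $G$ is a set $S\subseteq E(G)$ such that $G-S$ (the graph obtained by deleting the edges of $S$) is connected and has no perfect matching; the anti-Kekulé number $ak(G)$ is the smallest cardinality of an anti-Kekulé set of $G$. A toroidal fullerene (respectively, a Klein-bottle fullerene) is a connected cubic graph that has a cellular embedding in the torus (respectively, in the Klein bottle) such that every face is a hexagon, i.e. is bounded by a facial walk of length $6$. If $G$ is a toroidal fullerene or a bipartite Klein-bottle fullerene, then $G$ has an anti-Kekulé set and $ak(G)=4$. -/

import Mathlib

namespace SimpleGraph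

variable {V : Type*} (G : SimpleGraph V)

/-- `S` is an anti-Kekulé set of the connected graph `G`: a set of edges of `G` whose deletion
leaves a connected graph without perfect matchings. -/
def IsAntiKekuleSet (S : Set (Sym2 V)) : Prop :=
  G.Connected ∧ S ⊆ G.edgeSet ∧ (G.deleteEdges S).Connected ∧
    ¬ ∃ M : (G.deleteEdges S).Subgraph, M.IsPerfectMatching

/-- The anti-Kekulé number: the smallest cardinality of an anti-Kekulé set
(it is `⊤` if there is no anti-Kekulé set). -/
noncomputable def antiKekuleNumber : ℕ∞ :=
  ⨅ (S : Set (Sym2 V)) (_ : G.IsAntiKekuleSet S), S.encard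

/-- A cellular embedding of `G` in a closed surface, given as usual by a rotation system with
signature: `rot` permutes the darts (oriented edges) leaving each vertex in one single cycle (the
cyclic order in which they leave it, for some local orientation of the surface at that vertex), and
`sign e` is `1` or `-1` according to whether the local orientations chosen at the two ends of the
edge `e` agree along `e` or not. -/
structure SurfaceEmbedding where
  rot : Equiv.Perm G.Dart
  rot_fst : ∀ d : G.Dart, (rot d).fst = d.fst
  rot_sameCycle : ∀ d d' : G.Dart, d.fst = d'.fst → rot.SameCycle d d'
  sign : G.edgeSet → ℤˣ

namespace SurfaceEmbedding

variable {G} (M : G.SurfaceEmbedding)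

/-- The sign of the edge underlying a dart. -/
def dartSign (d : G.Dart) : ℤˣ := M.sign ⟨d.edge, d.edge_mem⟩

/-- One step of face tracing. In the state `(d, s)` we are about to traverse the dart `d`, and `s`
says whether we currently agree with the local orientation at the starting vertex of `d`. After the
traversal the orientation is updated by the sign of the edge, and we leave the new vertex by
the dart that is next to (if `s` is now `1`), or previous to (if `s` is now `-1`), the
reverse of `d` in the rotation. -/
def faceStep (x : G.Dart × ℤˣ) : G.Dart × ℤˣ :=
  ((M.rot ^ ((x.2 * M.dartSign x.1 : ℤˣ) : ℤ)) x.1.symm, x.2 * M.dartSign x.1)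

/-- The state which traverses the same side of the same edge in the opposite direction. -/
def reverse (x : G.Dart × ℤˣ) : G.Dart × ℤˣ :=
  (x.1.symm, -(x.2 * M.dartSign x.1))

/-- The faces: the facial walks, up to their starting point and their direction. -/
def Face : Type _ :=
  Quot fun x y : G.Dart × ℤˣ => y = M.faceStep x ∨ y = M.reverse x

/-- Every face is a hexagon, that is, every facial walk has length exactly six. -/
def AllFacesHexagons : Prop :=
  ∀ x : G.Dart × ℤˣ, Function.minimalPeriod M.faceStep x = 6

/-- The surface is orientable: after reversing some of the local orientations at
the vertices (by `ε`), they agree along every edge. -/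
def IsOrientable : Prop :=
  ∃ ε : V → ℤˣ, ∀ d : G.Dart, M.dartSign d = ε d.fst * ε d.snd

/-- The Euler characteristic of the surface (for a finite connected graph with at least
one edge). -/
noncomputable def eulerChar : ℤ :=
  (Nat.card V : ℤ) - Nat.card G.edgeSet + Nat.card M.Face

/-- The surface is a torus: orientable with Euler characteristic `0`. -/
def IsTorus : Prop := M.IsOrientable ∧ M.eulerChar = 0

/-- The surface is a Klein bottle: non-orientable with Euler characteristic `0`. -/
def IsKleinBottle : Prop := ¬ M.IsOrientable ∧ M.eulerChar = 0

end SurfaceEmbedding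

/-- A toroidal fullerene: a finite connected cubic graph that can be embedded in the torus
so that each face is a hexagon. -/
def IsToroidalFullerene [Fintype V] [DecidableRel G.Adj] : Prop :=
  G.Connected ∧ G.IsRegularOfDegree 3 ∧
    ∃ M : G.SurfaceEmbedding, M.IsTorus ∧ M.AllFacesHexagons

/-- A Klein-bottle fullerene: a finite connected cubic graph that can be embedded in the
Klein bottle so that each face is a hexagon. -/
def IsKleinBottleFullerene [Fintype V] [DecidableRel G.Adj] : Prop :=
  G.Connected ∧ G.IsRegularOfDegree 3 ∧
    ∃ M : G.SurfaceEmbedding, M.IsKleinBottle ∧ M.AllFacesHexagons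

end SimpleGraph

namespace SimpleGraph

/-! Both cases reduce to one combinatorial statement: a connected bipartite cubic graph in which
every path of length two lies on a hexagon has anti-Kekulé number four.

Lower bound: if deleting at most three edges destroys all perfect matchings, Hall gives a
monochromatic `X` with fewer neighbours `Y` than elements. Of the `3|X|` edges at `X` all but three
end in `Y`, which has only `3|Y| ≤ 3|X| - 3` edges, so equality holds. Then `X ∪ Y` is closed in the
remaining connected graph and is everything, whence `|X| ≤ |Y|`, a contradiction.

Upper bound: at two neighbours `p`, `q` of a vertex `b`, delete all edges except `pb` and `qb`. Then
`p` and `q` compete for `b`, so no perfect matching survives. If the rest were disconnected, a mod 3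
count (`Coloring.three_dvd_sum_cut`) would leave exactly three deleted edges in a cut, and moving
`p` or `q` across would give a 2-edge-cut, excluded by `PathsLieOnHexagons.no_two_cut`.

Toroidal fullerenes are bipartite because the triangle group (2,3,6), the rotation group of the
hexagonal tiling, acts on the darts. No rotation by an odd multiple of `π / 3` fixes a dart, so each
dart has a well-defined direction parity. This parity is constant around a vertex and flips along an
edge. -/

lemma Connected.eq_univ_of_adj_closed {V : Type*} {H : SimpleGraph V} (hH : H.Connected) {s : Set V}
    (hne : s.Nonempty) (hs : ∀ x ∈ s, ∀ y, H.Adj x y → y ∈ s) : s = Set.univ := by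
  obtain ⟨x, hx⟩ := hne
  refine Set.eq_univ_of_forall fun y => ?_
  obtain ⟨p⟩ := hH.preconnected x y
  induction p with
  | nil => exact hx
  | cons h _ ih => exact ih (hs _ hx _ h)

/-! ### Double counting: the lower bound and a mod 3 law for edge cuts. -/

section Cubic

variable {V : Type*} [Fintype V] {G : SimpleGraph V} [DecidableRel G.Adj]

lemma IsRegularOfDegree.card_filter_adj_left [DecidableEq V] {k : ℕ}
    (hreg : G.IsRegularOfDegree k) (X : Finset V) :
    ((X ×ˢ Finset.univ).filter fun p : V × V => G.Adj p.1 p.2).card = k * X.card := by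
  rw [Finset.card_filter, Finset.sum_product]
  have : ∀ x ∈ X, (∑ y : V, if G.Adj x y then 1 else 0) = k := fun x _ => by
    rw [← Finset.card_filter, ← hreg.degree_eq x, ← card_neighborFinset_eq_degree,
      neighborFinset_eq_filter]
  rw [Finset.sum_congr rfl this]
  simp [mul_comm]

lemma IsRegularOfDegree.card_filter_adj_right [DecidableEq V] {k : ℕ}
    (hreg : G.IsRegularOfDegree k) (Y : Finset V) :
    ((Finset.univ ×ˢ Y).filter fun p : V × V => G.Adj p.1 p.2).card = k * Y.card := by
  rw [← hreg.card_filter_adj_left Y]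
  refine Finset.card_bij (fun p _ => p.swap) ?_ ?_ ?_
  · simp +contextual [adj_comm]
  · intro a _ b _ h
    exact Prod.swap_injective h
  · rintro ⟨a, b⟩ h
    exact ⟨(b, a), by simpa [adj_comm] using h, rfl⟩

/-- In a graph without a perfect matching that has a proper `2`-colouring, some monochromatic set
of vertices has fewer neighbours than elements. -/
lemma exists_monochromatic_card_neighbors_lt [DecidableEq V] {H : SimpleGraph V}
    [DecidableRel H.Adj] (c : H.Coloring Bool) (hM : ¬ ∃ M : H.Subgraph, M.IsPerfectMatching) :
    ∃ (t : Bool) (X : Finset V), (∀ x ∈ X, c x = t) ∧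
      (Finset.univ.filter fun y => ∃ x ∈ X, H.Adj x y).card < X.card := by
  have hbip : H.IsBipartiteWith {v | c v = true} {v | c v = false} := by
    refine ⟨Set.disjoint_left.2 fun v h h' => ?_, fun v w h => ?_⟩
    · simp_all
    · have := c.valid h
      simp only [Set.mem_ofPred_eq]
      cases hv : c v <;> cases hw : c w <;> simp_all
  by_contra! hcon
  refine hM (exists_isPerfectMatching_of_forall_ncard_le hbip fun s => ?_)
  set X : Finset V := s.toFinite.toFinset
  have hs : s = (X : Set V) := by simp [X]
  have hN : (⋃ x ∈ s, H.neighborSet x) =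
      ((Finset.univ.filter fun y => ∃ x ∈ X, H.Adj x y : Finset V) : Set V) := by
    ext y
    simp [X]
  rw [hN, Set.ncard_coe_finset, hs, Set.ncard_coe_finset]
  -- Monochromatic sets suffice for Hall's condition: the two colour classes of `X` have
  -- neighbourhoods of opposite colours, hence disjoint.
  have h := fun t => hcon t (X.filter fun x => c x = t) (by simp)
  have hX : X.card = (X.filter fun x => c x = true).card + (X.filter fun x => c x = false).card := by
    rw [← Finset.card_filter_add_card_filter_not (s := X) (fun x => c x = true)]
    simp
  rw [hX]
  refine (add_le_add (h true) (h false)).trans ?_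
  rw [← Finset.card_union_of_disjoint]
  · refine Finset.card_le_card fun y => ?_
    simp only [Finset.mem_union, Finset.mem_filter, Finset.mem_univ, true_and]
    rintro (⟨x, hx, hxy⟩ | ⟨x, hx, hxy⟩) <;> exact ⟨x, hx.1, hxy⟩
  · refine Finset.disjoint_left.2 fun y => ?_
    simp only [Finset.mem_filter, Finset.mem_univ, true_and]
    rintro ⟨x, hx, hxy⟩ ⟨x', hx', hxy'⟩
    have h1 := c.valid hxy
    have h2 := c.valid hxy'
    rw [hx.2] at h1
    rw [hx'.2] at h2
    cases hy : c y <;> simp_all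

/-- An anti-Kekulé set of a bipartite cubic graph has at least four edges. -/
theorem IsAntiKekuleSet.four_le_encard (hreg : G.IsRegularOfDegree 3) (c : G.Coloring Bool)
    {S : Set (Sym2 V)} (hS : G.IsAntiKekuleSet S) : 4 ≤ S.encard := by
  classical
  obtain ⟨-, -, hconn, hM⟩ := hS
  have hle : G.deleteEdges S ≤ G := deleteEdges_le S
  obtain ⟨t, X, hX, hlt⟩ := exists_monochromatic_card_neighbors_lt
    (c.comp (Hom.ofLE hle)) hM
  replace hX : ∀ x ∈ X, c x = t := hX
  set Y : Finset V := Finset.univ.filter fun y => ∃ x ∈ X, (G.deleteEdges S).Adj x y with hY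
  have hYmem : ∀ y, y ∈ Y ↔ ∃ x ∈ X, (G.deleteEdges S).Adj x y := by simp [hY]
  clear_value Y
  by_contra! hS4
  obtain ⟨T, rfl⟩ : ∃ T : Finset (Sym2 V), (T : Set (Sym2 V)) = S :=
    ⟨S.toFinite.toFinset, by simp⟩
  rw [Set.encard_coe_eq_coe_finsetCard] at hS4
  have hT : T.card ≤ 3 := by
    have : T.card < 4 := by exact_mod_cast hS4
    omega
  have hP := hreg.card_filter_adj_left X
  have hQ := hreg.card_filter_adj_right Y
  set P := (X ×ˢ Finset.univ).filter fun p : V × V => G.Adj p.1 p.2 with hPdef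
  set Q := (Finset.univ ×ˢ Y).filter fun p : V × V => G.Adj p.1 p.2 with hQdef
  have hsplit := Finset.card_filter_add_card_filter_not (s := P) (fun p => s(p.1, p.2) ∈ T)
  have hPT : (P.filter fun p => s(p.1, p.2) ∈ T).card ≤ T.card := by
    refine Finset.card_le_card_of_injOn (fun p => s(p.1, p.2)) (by
      intro p hp
      exact (Finset.mem_filter.1 hp).2) ?_
    rintro ⟨a, b⟩ hp ⟨a', b'⟩ hp' h
    simp only [Finset.coe_filter, Set.mem_ofPred_eq, hPdef, Finset.mem_filter, Finset.mem_product,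
      Finset.mem_univ, and_true] at hp hp'
    simp only [Sym2.eq_iff] at h
    rcases h with ⟨rfl, rfl⟩ | ⟨rfl, rfl⟩
    · rfl
    · exact absurd ((hX _ hp.1.1).trans (hX _ hp'.1.1).symm) (c.valid hp.1.2)
  have hsub : (P.filter fun p => ¬ s(p.1, p.2) ∈ T) ⊆ Q := by
    rintro ⟨a, b⟩ hp
    simp only [hPdef, hQdef, hYmem, Finset.mem_filter, Finset.mem_product, Finset.mem_univ, and_true,
      true_and, deleteEdges_adj, Finset.mem_coe] at hp ⊢
    exact ⟨⟨a, hp.1.1, hp.1.2, hp.2⟩, hp.1.2⟩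
  have hcard := Finset.card_le_card hsub
  -- Here `3|X| - 3 ≤ |P| - |T| ≤ |Q| = 3|Y| ≤ 3|X| - 3`, so the inclusion is an equality and every
  -- edge of `G` at `Y` comes from `X`.
  have heq := Finset.eq_of_subset_of_card_le hsub (by omega)
  have hYX : ∀ y ∈ Y, ∀ x, G.Adj x y → x ∈ X := by
    intro y hy x hxy
    have : (x, y) ∈ Q := by simp [hQdef, hy, hxy]
    rw [← heq] at this
    simp only [hPdef, Finset.mem_filter, Finset.mem_product] at this
    exact this.1.1.1
  have huniv := hconn.eq_univ_of_adj_closed (s := (X ∪ Y : Finset V)) (by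
      obtain ⟨x, hx⟩ := Finset.card_pos.1 (Nat.zero_lt_of_lt hlt)
      exact ⟨x, by simp [hx]⟩) (by
      intro x hx y hxy
      rcases Finset.mem_union.1 (Finset.mem_coe.1 hx) with hx | hx
      · exact Finset.mem_coe.2 (Finset.mem_union_right _ ((hYmem y).2 ⟨x, hx, hxy⟩))
      · exact Finset.mem_coe.2 (Finset.mem_union_left _ (hYX x hx y (hle hxy).symm)))
  have hPQ : P ⊆ Q := by
    rintro ⟨a, b⟩ hp
    simp only [hPdef, hQdef, Finset.mem_filter, Finset.mem_product, Finset.mem_univ, and_true,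
      true_and] at hp ⊢
    refine ⟨?_, hp.2⟩
    have hb : b ∈ X ∪ Y := by
      have : b ∈ ((X ∪ Y : Finset V) : Set V) := huniv ▸ Set.mem_univ b
      exact Finset.mem_coe.1 this
    rcases Finset.mem_union.1 hb with hb | hb
    · exact absurd ((hX _ hp.1).trans (hX _ hb).symm) (c.valid hp.2)
    · exact hb
  have := Finset.card_le_card hPQ
  omega

/-- The edges of a cubic graph that leave a set of vertices are balanced modulo three between the
two colours. -/
lemma Coloring.three_dvd_sum_cut [DecidableEq V] (hreg : G.IsRegularOfDegree 3)
    (c : G.Coloring Bool) (D : Finset V) :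
    (3 : ℤ) ∣ ∑ p ∈ (D ×ˢ Dᶜ).filter (fun p : V × V => G.Adj p.1 p.2),
      (if c p.1 then (1 : ℤ) else -1) := by
  set σ : V → ℤ := fun x => if c x then (1 : ℤ) else -1
  have hσ : ∀ x y, G.Adj x y → σ y = -σ x := by
    intro x y h
    have := c.valid h
    simp only [σ]
    cases hx : c x <;> cases hy : c y <;> simp_all
  -- An edge inside `D` is counted in both directions, with opposite signs.
  have hin : ∑ p ∈ (D ×ˢ D).filter (fun p : V × V => G.Adj p.1 p.2), σ p.1 = 0 := by
    have h1 : ∑ p ∈ (D ×ˢ D).filter (fun p : V × V => G.Adj p.1 p.2), σ p.1 =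
        ∑ p ∈ (D ×ˢ D).filter (fun p : V × V => G.Adj p.1 p.2), σ p.2 := by
      refine Finset.sum_bij (fun p _ => p.swap) ?_ ?_ ?_ ?_
      · simp +contextual [adj_comm]
      · intro a _ b _ h
        exact Prod.swap_injective h
      · rintro ⟨a, b⟩ h
        exact ⟨(b, a), by simpa [adj_comm, and_comm] using h, rfl⟩
      · intros
        rfl
    have h2 : ∑ p ∈ (D ×ˢ D).filter (fun p : V × V => G.Adj p.1 p.2), σ p.2 =
        ∑ p ∈ (D ×ˢ D).filter (fun p : V × V => G.Adj p.1 p.2), -σ p.1 :=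
      Finset.sum_congr rfl fun p hp => hσ _ _ (Finset.mem_filter.1 hp).2
    rw [Finset.sum_neg_distrib] at h2
    omega
  have hall : ∑ p ∈ (D ×ˢ Finset.univ).filter (fun p : V × V => G.Adj p.1 p.2), σ p.1 =
      3 * ∑ x ∈ D, σ x := by
    rw [Finset.sum_filter, Finset.sum_product, Finset.mul_sum]
    refine Finset.sum_congr rfl fun x _ => ?_
    rw [← Finset.sum_filter]
    change ∑ y with G.Adj x y, σ x = _
    rw [Finset.sum_const, ← neighborFinset_eq_filter,
      card_neighborFinset_eq_degree, hreg.degree_eq x]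
    simp
  have hsplit : (D ×ˢ Finset.univ).filter (fun p : V × V => G.Adj p.1 p.2) =
      (D ×ˢ D).filter (fun p : V × V => G.Adj p.1 p.2) ∪
        (D ×ˢ Dᶜ).filter (fun p : V × V => G.Adj p.1 p.2) := by
    ext p
    simp only [Finset.mem_filter, Finset.mem_product, Finset.mem_union, Finset.mem_univ,
      Finset.mem_compl]
    tauto
  rw [hsplit, Finset.sum_union, hin, zero_add] at hall
  · exact ⟨_, hall⟩
  · refine Finset.disjoint_left.2 fun p => ?_
    simp only [Finset.mem_filter, Finset.mem_product, Finset.mem_compl]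
    tauto

end Cubic

end SimpleGraph

/-! ### Two-edge-cuts and the construction of a four-edge anti-Kekulé set. -/

namespace SimpleGraph

/-- Every path with two edges lies on a closed walk of length six without backtracking. -/
def PathsLieOnHexagons {V : Type*} (G : SimpleGraph V) : Prop :=
  ∀ a b c, G.Adj a b → G.Adj b c → a ≠ c → ∃ x y z, G.Adj c x ∧ G.Adj x y ∧ G.Adj y z ∧
    G.Adj z a ∧ x ≠ b ∧ y ≠ c ∧ x ≠ z ∧ y ≠ a ∧ z ≠ b

lemma Coloring.eq_of_adj_of_adj {V : Type*} {G : SimpleGraph V} (c : G.Coloring Bool) {x y z : V}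
    (h : G.Adj x y) (h' : G.Adj y z) : c x = c z := by
  have h1 := c.valid h
  have h2 := c.valid h'
  cases hx : c x <;> cases hy : c y <;> cases hz : c z <;> simp_all

/-- Between one and four of the propositions hold, so exactly three do. The cases are grouped so
that one of the pairs `P, Q` and `R, T` is complete. -/
lemma exactly_three_of_three_dvd {P Q R T : Prop} [Decidable P] [Decidable Q] [Decidable R]
    [Decidable T]
    (h : (3 : ℤ) ∣ (if P then 1 else 0) + ((if Q then 1 else 0) +
      ((if R then 1 else 0) + (if T then 1 else 0)))) (hone : P ∨ Q ∨ R ∨ T) :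
    (P ∧ Q ∧ R ∧ ¬ T) ∨ (P ∧ Q ∧ T ∧ ¬ R) ∨ (R ∧ T ∧ P ∧ ¬ Q) ∨ (R ∧ T ∧ Q ∧ ¬ P) := by
  by_cases hP : P <;> by_cases hQ : Q <;> by_cases hR : R <;> by_cases hT : T <;>
    simp [hP, hQ, hR, hT] at h hone ⊢

section Cubic

variable {V : Type*} [Fintype V] {G : SimpleGraph V} [DecidableRel G.Adj]

lemma IsRegularOfDegree.exists_neighbors (hreg : G.IsRegularOfDegree 3) (v : V) :
    ∃ a b c, a ≠ b ∧ a ≠ c ∧ b ≠ c ∧ ∀ x, G.Adj v x ↔ x = a ∨ x = b ∨ x = c := by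
  classical
  obtain ⟨a, b, c, hab, hac, hbc, h⟩ := Finset.card_eq_three.1 (hreg.degree_eq v)
  refine ⟨a, b, c, hab, hac, hbc, fun x => ?_⟩
  rw [← mem_neighborFinset, h]
  simp

lemma IsRegularOfDegree.exists_other_neighbors (hreg : G.IsRegularOfDegree 3) {v a : V}
    (ha : G.Adj v a) : ∃ b c, a ≠ b ∧ a ≠ c ∧ b ≠ c ∧ ∀ x, G.Adj v x ↔ x = a ∨ x = b ∨ x = c := by
  obtain ⟨p, q, r, hpq, hpr, hqr, h⟩ := hreg.exists_neighbors v
  rcases (h a).1 ha with rfl | rfl | rfl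
  · exact ⟨q, r, hpq, hpr, hqr, h⟩
  · exact ⟨p, r, hpq.symm, hqr, hpr, fun x => by rw [h]; tauto⟩
  · exact ⟨p, q, hpr.symm, hqr.symm, hpq, fun x => by rw [h]; tauto⟩

lemma IsRegularOfDegree.exists_third_neighbor (hreg : G.IsRegularOfDegree 3) {v a b : V}
    (ha : G.Adj v a) (hb : G.Adj v b) (hab : a ≠ b) :
    ∃ c, c ≠ a ∧ c ≠ b ∧ ∀ x, G.Adj v x ↔ x = a ∨ x = b ∨ x = c := by
  obtain ⟨p, q, hp, hq, hpq, h⟩ := hreg.exists_other_neighbors ha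
  rcases (h b).1 hb with rfl | rfl | rfl
  · exact absurd rfl hab
  · exact ⟨q, hq.symm, hpq.symm, h⟩
  · exact ⟨p, hp.symm, hpq, fun x => by rw [h]; tauto⟩

/-- The two edges of a `2`-edge-cut have ends of different colours on each side. -/
lemma Coloring.ne_of_two_cut (hreg : G.IsRegularOfDegree 3) (c : G.Coloring Bool) {D : Finset V}
    {u u' w w' : V} (hu : u ∈ D) (hu' : u' ∉ D) (hw : w ∈ D) (hw' : w' ∉ D) (huu : G.Adj u u')
    (hww : G.Adj w w') (hne : ¬ (u = w ∧ u' = w'))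
    (hcut : ∀ x ∈ D, ∀ y ∉ D, G.Adj x y → (x = u ∧ y = u') ∨ (x = w ∧ y = w')) : c u ≠ c w := by
  classical
  have h := c.three_dvd_sum_cut hreg D
  have hD : (D ×ˢ Dᶜ).filter (fun p : V × V => G.Adj p.1 p.2) = {(u, u'), (w, w')} := by
    ext ⟨x, y⟩
    simp only [Finset.mem_filter, Finset.mem_product, Finset.mem_compl, Finset.mem_insert,
      Finset.mem_singleton, Prod.mk.injEq]
    constructor
    · rintro ⟨⟨hx, hy⟩, hxy⟩
      exact hcut x hx y hy hxy
    · rintro (⟨rfl, rfl⟩ | ⟨rfl, rfl⟩)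
      · exact ⟨⟨hu, hu'⟩, huu⟩
      · exact ⟨⟨hw, hw'⟩, hww⟩
  -- Ends of equal colour would make the signed sum `±2`, which is not divisible by three.
  rw [hD, Finset.sum_pair (by simpa using hne)] at h
  intro heq
  rw [heq] at h
  cases hcw : c w <;> norm_num [hcw] at h

/-- A bipartite cubic graph whose paths of length two lie on hexagons has no `2`-edge-cut. -/
theorem PathsLieOnHexagons.no_two_cut (hreg : G.IsRegularOfDegree 3) (c : G.Coloring Bool)
    (hex : G.PathsLieOnHexagons) (D : Finset V)
    {u u' w w' : V} (hu : u ∈ D) (hu' : u' ∉ D) (hw : w ∈ D) (hw' : w' ∉ D) (huu : G.Adj u u')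
    (hww : G.Adj w w') (hne : ¬ (u = w ∧ u' = w'))
    (hcut : ∀ x ∈ D, ∀ y ∉ D, G.Adj x y → (x = u ∧ y = u') ∨ (x = w ∧ y = w')) : False := by
  classical
  induction hn : D.card using Nat.strong_induction_on generalizing D u u' w w' with
  | _ n ih =>
  have hcol := c.ne_of_two_cut hreg hu hu' hw hw' huu hww hne hcut
  have huw_ne : u ≠ w := fun h => hcol (h ▸ rfl)
  -- A hexagon through `u`, `u'` and `p ≠ w'` must cross the cut a second time. The colours and `p ≠
  -- w'` force this crossing to be the edge from `z = w` to `y = w'`, and `z` is adjacent to `u`.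
  have huw : G.Adj u w := by
    obtain ⟨p, hp, hpw, hpu⟩ : ∃ p, G.Adj u' p ∧ p ≠ w' ∧ p ≠ u := by
      obtain ⟨a, b, hua, hub, hab, h⟩ := hreg.exists_other_neighbors huu.symm
      by_cases haw : a = w'
      · exact ⟨b, (h b).2 (by simp), fun hb => hab (haw.trans hb.symm), hub.symm⟩
      · exact ⟨a, (h a).2 (by simp), haw, hua.symm⟩
    obtain ⟨x, y, z, hpx, hxy, hyz, hzu, hxu', hyp, hxz, hyu, hzu'⟩ :=
      hex u u' p huu hp hpu.symm
    have hcyu : c y ≠ c w := by rwa [c.eq_of_adj_of_adj hyz hzu]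
    have hcpu : c p ≠ c w := by rwa [c.eq_of_adj_of_adj hpx hxy]
    have hzD : z ∈ D := by
      by_contra hz
      rcases hcut u hu z hz hzu.symm with h | h
      · exact hzu' h.2
      · exact huw_ne h.1
    by_cases hyD : y ∈ D
    · have hxD : x ∈ D := by
        by_contra hx
        rcases hcut y hyD x hx hxy.symm with h | h
        · exact hyu h.1
        · exact hcyu (h.1 ▸ rfl)
      have hpD : p ∈ D := by
        by_contra hpD
        rcases hcut x hxD p hpD hpx.symm with h | h
        · exact c.valid hxy ((congrArg c h.1).trans (c.eq_of_adj_of_adj hyz hzu).symm)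
        · exact hpw h.2
      rcases hcut p hpD u' hu' hp.symm with h | h
      · exact absurd h.1 hpu
      · exact absurd (h.1 ▸ rfl) hcpu
    · rcases hcut z hzD y hyD hyz.symm with h | h
      · exact absurd h.1 hzu.ne
      · exact h.1 ▸ hzu.symm
  obtain ⟨x, hxu', hxw, hx⟩ := hreg.exists_third_neighbor huu huw (fun h => hu' (h ▸ hw))
  obtain ⟨y, hyw', hyu, hy⟩ := hreg.exists_third_neighbor hww huw.symm (fun h => hw' (h ▸ hu))
  have hux : G.Adj u x := (hx x).2 (by simp)
  have hwy : G.Adj w y := (hy y).2 (by simp)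
  have hxD : x ∈ D := by
    by_contra h
    rcases hcut u hu x h hux with h | h
    · exact hxu' h.2
    · exact huw_ne h.1
  have hyD : y ∈ D := by
    by_contra h
    rcases hcut w hw y h hwy with h | h
    · exact huw_ne h.1.symm
    · exact hyw' h.2
  -- Since `u` and `w` are adjacent, each has one remaining edge, leading into `D`. These two edges
  -- cut off `D` without `u` and `w`, giving an infinite descent.
  refine ih ((D.erase u).erase w).card ?_ ((D.erase u).erase w) (u := x) (u' := u) (w := y)
    (w' := w) ?_ ?_ ?_ ?_ hux.symm hwy.symm (fun h => huw_ne h.2) ?_ rfl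
  · rw [← hn]
    exact (Finset.card_erase_le).trans_lt (Finset.card_erase_lt_of_mem hu)
  · simp [hxD, hxw, hux.ne']
  · simp
  · simp [hyD, hyu, hwy.ne']
  · simp
  · intro a ha b hb hab
    simp only [Finset.mem_erase, not_and] at ha hb
    obtain ⟨haw, hau, haD⟩ := ha
    by_cases hbD : b ∈ D
    · by_cases hbw : b = w
      · subst hbw
        rcases (hy a).1 hab.symm with rfl | rfl | rfl
        · exact absurd haD hw'
        · exact absurd rfl hau
        · exact Or.inr ⟨rfl, rfl⟩
      · have hbu : b = u := by
          by_contra hbu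
          exact hb hbw hbu hbD
        subst hbu
        rcases (hx a).1 hab.symm with rfl | rfl | rfl
        · exact absurd haD hu'
        · exact absurd rfl haw
        · exact Or.inl ⟨rfl, rfl⟩
    · rcases hcut a haD b hbD hab with h | h
      · exact absurd h.1 hau
      · exact absurd h.1 haw

/-- A connected bipartite cubic graph whose paths of length two lie on hexagons has an anti-Kekulé
set with at most four edges. -/
theorem PathsLieOnHexagons.exists_isAntiKekuleSet (hconn : G.Connected)
    (hreg : G.IsRegularOfDegree 3) (c : G.Coloring Bool) (hex : G.PathsLieOnHexagons) :
    ∃ S, G.IsAntiKekuleSet S ∧ S.encard ≤ 4 := by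
  classical
  obtain ⟨b⟩ := hconn.nonempty
  obtain ⟨p, q, r, hpq, hpr, hqr, hb⟩ := hreg.exists_neighbors b
  have hbp : G.Adj b p := (hb p).2 (by simp)
  have hbq : G.Adj b q := (hb q).2 (by simp)
  obtain ⟨p₁, p₂, hp₁, hp₂, hp₁₂, hp⟩ := hreg.exists_other_neighbors hbp.symm
  obtain ⟨q₁, q₂, hq₁, hq₂, hq₁₂, hq⟩ := hreg.exists_other_neighbors hbq.symm
  have hpp₁ : G.Adj p p₁ := (hp _).2 (by simp)
  have hpp₂ : G.Adj p p₂ := (hp _).2 (by simp)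
  have hqq₁ : G.Adj q q₁ := (hq _).2 (by simp)
  have hqq₂ : G.Adj q q₂ := (hq _).2 (by simp)
  set S : Set (Sym2 V) := {s(p, p₁), s(p, p₂), s(q, q₁), s(q, q₂)} with hS
  have hcut : ∀ x y, G.Adj x y → s(x, y) ∈ S → (x = p ∧ (y = p₁ ∨ y = p₂)) ∨
      (y = p ∧ (x = p₁ ∨ x = p₂)) ∨ (x = q ∧ (y = q₁ ∨ y = q₂)) ∨
      (y = q ∧ (x = q₁ ∨ x = q₂)) := by
    intro x y _ hxy
    simp only [hS, Set.mem_insert_iff, Set.mem_singleton_iff, Sym2.eq_iff] at hxy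
    rcases hxy with (h | h) | (h | h) | (h | h) | (h | h) <;> simp [h]
  have hSp : ∀ y, (G.deleteEdges S).Adj p y → y = b := by
    intro y hy
    rw [deleteEdges_adj] at hy
    rcases (hp y).1 hy.1 with rfl | rfl | rfl
    · rfl
    · exact absurd (by simp [hS]) hy.2
    · exact absurd (by simp [hS]) hy.2
  have hSq : ∀ y, (G.deleteEdges S).Adj q y → y = b := by
    intro y hy
    rw [deleteEdges_adj] at hy
    rcases (hq y).1 hy.1 with rfl | rfl | rfl
    · rfl
    · exact absurd (by simp [hS]) hy.2
    · exact absurd (by simp [hS]) hy.2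
  have hc₁ : c p₁ = c b := c.eq_of_adj_of_adj hpp₁.symm hbp.symm
  have hc₂ : c p₂ = c b := c.eq_of_adj_of_adj hpp₂.symm hbp.symm
  have hd₁ : c q₁ = c b := c.eq_of_adj_of_adj hqq₁.symm hbq.symm
  have hd₂ : c q₂ = c b := c.eq_of_adj_of_adj hqq₂.symm hbq.symm
  have hSb : ∀ y, G.Adj b y → (G.deleteEdges S).Adj b y := by
    intro y hy
    rw [deleteEdges_adj]
    refine ⟨hy, fun h => ?_⟩
    rcases hcut b y hy h with h | h | h | h
    · exact hbp.ne h.1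
    · rcases h.2 with h | h
      · exact hp₁ h
      · exact hp₂ h
    · exact hbq.ne h.1
    · rcases h.2 with h | h
      · exact hq₁ h
      · exact hq₂ h
  refine ⟨S, ⟨hconn, ?_, ?_, ?_⟩, ?_⟩
  · rintro e (rfl | rfl | rfl | rfl) <;> assumption
  · by_contra hdis
    -- Every edge leaving `D` is a deleted one, directed from some `pᵢ` to `p` or from some `qᵢ` to
    -- `q`.
    set D : Finset V := Finset.univ.filter fun x => ¬ (G.deleteEdges S).Reachable b x with hD
    have hmem : ∀ x, x ∈ D ↔ ¬ (G.deleteEdges S).Reachable b x := by simp [hD]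
    have hbD : b ∉ D := by simp [hmem]
    have hpD : p ∉ D := by
      rw [hmem, not_not]
      exact (hSb p hbp).reachable
    have hqD : q ∉ D := by
      rw [hmem, not_not]
      exact (hSb q hbq).reachable
    have hDcut : ∀ x ∈ D, ∀ y ∉ D, G.Adj x y →
        (y = p ∧ (x = p₁ ∨ x = p₂)) ∨ (y = q ∧ (x = q₁ ∨ x = q₂)) := by
      intro x hx y hy hxy
      have hxyS : s(x, y) ∈ S := by
        by_contra hxyS
        rw [hmem] at hx hy
        rw [not_not] at hy
        refine hx (hy.trans ?_)
        have : (G.deleteEdges S).Adj x y := by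
          rw [deleteEdges_adj]
          exact ⟨hxy, hxyS⟩
        exact this.symm.reachable
      rcases hcut x y hxy hxyS with h | h | h | h
      · exact absurd (h.1 ▸ hx) hpD
      · exact Or.inl h
      · exact absurd (h.1 ▸ hx) hqD
      · exact Or.inr h
    -- With three cut edges, two of them at `p`, moving `p` into `D` replaces those two by `pb` and
    -- leaves a 2-edge-cut. The vertices are quantified so that `p` and `q` can be exchanged.
    have key : ∀ {p p₁ p₂ q q₁ q₂ : V}, p ∉ D → q ∉ D → p ≠ q → G.Adj b p → G.Adj q q₁ →
        (∀ x, G.Adj p x ↔ x = b ∨ x = p₁ ∨ x = p₂) → p₁ ∈ D → p₂ ∈ D → q₁ ∈ D → q₂ ∉ D →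
        (∀ x ∈ D, ∀ y ∉ D, G.Adj x y →
          (y = p ∧ (x = p₁ ∨ x = p₂)) ∨ (y = q ∧ (x = q₁ ∨ x = q₂))) → False := by
      intro p p₁ p₂ q q₁ q₂ hpD hqD hpq hbp hqq₁ hp h1 h2 h3 h4 hDcut
      refine hex.no_two_cut hreg c (insert p D) (u := p) (u' := b) (w := q₁) (w' := q)
        (by simp) (by simp [hbp.ne, hbD]) (by simp [h3]) (by simp [hpq.symm, hqD]) hbp.symm
        hqq₁.symm ?_ ?_
      · rintro ⟨rfl, -⟩
        exact hpD h3
      · intro x hx y hy hxy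
        rw [Finset.mem_insert, not_or] at hy
        rcases Finset.mem_insert.1 hx with rfl | hx
        · rcases (hp y).1 hxy with rfl | rfl | rfl
          · exact Or.inl ⟨rfl, rfl⟩
          · exact absurd h1 hy.2
          · exact absurd h2 hy.2
        · rcases hDcut x hx y hy.2 hxy with h | h
          · exact absurd h.1 hy.1
          · rcases h.2 with h' | h'
            · exact Or.inr ⟨h', h.1⟩
            · exact absurd (h' ▸ hx) h4
    have hcount : (3 : ℤ) ∣ (if p₁ ∈ D then 1 else 0) + ((if p₂ ∈ D then 1 else 0) +
        ((if q₁ ∈ D then 1 else 0) + (if q₂ ∈ D then 1 else 0))) := by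
      have h := c.three_dvd_sum_cut hreg D
      have hDeq : (D ×ˢ Dᶜ).filter (fun p : V × V => G.Adj p.1 p.2) =
          ({(p₁, p), (p₂, p), (q₁, q), (q₂, q)} : Finset (V × V)).filter fun x => x.1 ∈ D := by
        ext ⟨x, y⟩
        simp only [Finset.mem_filter, Finset.mem_product, Finset.mem_compl, Finset.mem_insert,
          Finset.mem_singleton, Prod.mk.injEq]
        constructor
        · rintro ⟨⟨hx, hy⟩, hxy⟩
          refine ⟨?_, hx⟩
          rcases hDcut x hx y hy hxy with ⟨h, h' | h'⟩ | ⟨h, h' | h'⟩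
          · exact Or.inl ⟨h', h⟩
          · exact Or.inr (Or.inl ⟨h', h⟩)
          · exact Or.inr (Or.inr (Or.inl ⟨h', h⟩))
          · exact Or.inr (Or.inr (Or.inr ⟨h', h⟩))
        · rintro ⟨h | h | h | h, hx⟩ <;> obtain ⟨rfl, rfl⟩ := h
          · exact ⟨⟨hx, hpD⟩, hpp₁.symm⟩
          · exact ⟨⟨hx, hpD⟩, hpp₂.symm⟩
          · exact ⟨⟨hx, hqD⟩, hqq₁.symm⟩
          · exact ⟨⟨hx, hqD⟩, hqq₂.symm⟩
      rw [hDeq, Finset.sum_filter, Finset.sum_insert (by simp [hp₁₂, hpq]),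
        Finset.sum_insert (by simp [hpq]), Finset.sum_insert (by simp [hq₁₂]),
        Finset.sum_singleton] at h
      -- The inner ends all have the colour of `b`, so the signed sum is plus or minus the number of
      -- cut edges.
      simp only [hc₁, hc₂, hd₁, hd₂] at h
      cases hcb : c b <;> simp only [hcb] at h
      · rw [← dvd_neg]
        refine h.trans (dvd_of_eq ?_)
        simp only [Bool.false_eq_true, if_false, neg_add]
        congr 1
        · split_ifs <;> rfl
        · congr 1
          · split_ifs <;> rfl
          · congr 1 <;> split_ifs <;> rfl
      · simpa only [if_true] using h
    have hone : p₁ ∈ D ∨ p₂ ∈ D ∨ q₁ ∈ D ∨ q₂ ∈ D := by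
      by_contra! hno
      have huniv := hconn.eq_univ_of_adj_closed (s := {x | x ∉ D}) ⟨b, hbD⟩ (by
        intro x hx y hxy hy
        rcases hDcut y hy x hx hxy.symm with ⟨-, rfl | rfl⟩ | ⟨-, rfl | rfl⟩
        · exact hno.1 hy
        · exact hno.2.1 hy
        · exact hno.2.2.1 hy
        · exact hno.2.2.2 hy)
      apply hdis
      have : ∀ x, (G.deleteEdges S).Reachable b x := fun x => by
        have : x ∈ {x | x ∉ D} := huniv ▸ Set.mem_univ x
        change x ∉ D at this
        rwa [hmem, not_not] at this
      exact (connected_iff_exists_forall_reachable _).2 ⟨b, this⟩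
    rcases exactly_three_of_three_dvd hcount hone with
      ⟨h1, h2, h3, h4⟩ | ⟨h1, h2, h4, h3⟩ | ⟨h3, h4, h1, h2⟩ | ⟨h3, h4, h2, h1⟩
    · exact key hpD hqD hpq hbp hqq₁ hp h1 h2 h3 h4 hDcut
    · exact key hpD hqD hpq hbp hqq₂ hp h1 h2 h4 h3 fun x hx y hy hxy =>
        (hDcut x hx y hy hxy).imp_right fun h => ⟨h.1, h.2.symm⟩
    · exact key hqD hpD hpq.symm hbq hpp₁ hq h3 h4 h1 h2 fun x hx y hy hxy =>
        (hDcut x hx y hy hxy).symm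
    · exact key hqD hpD hpq.symm hbq hpp₂ hq h3 h4 h2 h1 fun x hx y hy hxy =>
        (hDcut x hx y hy hxy).symm.imp_right fun h => ⟨h.1, h.2.symm⟩
  · rintro ⟨M, hM⟩
    rw [Subgraph.isPerfectMatching_iff] at hM
    obtain ⟨y, hy, -⟩ := hM p
    obtain ⟨z, hz, -⟩ := hM q
    obtain rfl := hSp y hy.adj_sub
    obtain rfl := hSq z hz.adj_sub
    exact hpq ((hM z).unique hy.symm hz.symm)
  · refine (Set.encard_insert_le _ _).trans ?_
    refine (add_le_add_left (Set.encard_insert_le _ _) 1).trans ?_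
    refine (add_le_add_left (add_le_add_left (Set.encard_insert_le _ _) 1) 1).trans ?_
    rw [Set.encard_singleton]
    norm_num

/-- A connected bipartite cubic graph whose paths of length two lie on hexagons has anti-Kekulé
number four. -/
theorem PathsLieOnHexagons.antiKekuleNumber_eq_four (hconn : G.Connected)
    (hreg : G.IsRegularOfDegree 3) (hbip : G.IsBipartite) (hex : G.PathsLieOnHexagons) :
    G.antiKekuleNumber = 4 := by
  obtain ⟨c'⟩ := hbip
  let c : G.Coloring Bool := Coloring.mk (fun v => finTwoEquiv (c' v)) fun h h' =>
    c'.valid h (finTwoEquiv.injective h')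
  refine le_antisymm ?_ (le_iInf₂ fun S hS => hS.four_le_encard hreg c)
  obtain ⟨S, hS, hle⟩ := hex.exists_isAntiKekuleSet hconn hreg c
  exact (iInf₂_le S hS).trans hle

end Cubic

end SimpleGraph

/-! ### Rotations at cubic vertices and facial walks. -/

namespace SimpleGraph.SurfaceEmbedding

lemma rot_symm_fst {V : Type*} {G : SimpleGraph V} (M : G.SurfaceEmbedding) (d : G.Dart) :
    (M.rot⁻¹ d).fst = d.fst := by
  have h := M.rot_fst (M.rot⁻¹ d)
  rw [show M.rot (M.rot⁻¹ d) = d from M.rot.apply_symm_apply d] at h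
  exact h.symm

lemma rot_zpow_fst {V : Type*} {G : SimpleGraph V} (M : G.SurfaceEmbedding) (σ : ℤˣ)
    (d : G.Dart) :
    ((M.rot ^ (σ : ℤ)) d).fst = d.fst := by
  rcases Int.units_eq_one_or σ with rfl | rfl
  · simpa using M.rot_fst d
  · simpa using M.rot_symm_fst d

lemma faceStep_fst {V : Type*} {G : SimpleGraph V} (M : G.SurfaceEmbedding)
    (x : G.Dart × ℤˣ) : (M.faceStep x).1.fst = x.1.snd :=
  M.rot_zpow_fst _ _

variable {V : Type*} [Fintype V] {G : SimpleGraph V} [DecidableRel G.Adj]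

/-- A nonempty set of darts at a vertex of a cubic graph that is closed under rotation consists of
three darts. -/
lemma three_le_card_of_rot_closed (M : G.SurfaceEmbedding) (hreg : G.IsRegularOfDegree 3)
    {d : G.Dart} (F : Finset G.Dart) (hd : d ∈ F) (hF : ∀ e ∈ F, M.rot e ∈ F) : 3 ≤ F.card := by
  classical
  have hcard := G.dart_fst_fiber_card_eq_degree d.fst
  rw [hreg.degree_eq] at hcard
  rw [← hcard]
  refine Finset.card_le_card fun e he => ?_
  obtain ⟨n, -, rfl⟩ := (M.rot_sameCycle d e (Finset.mem_filter.1 he).2.symm).exists_pow_eq'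
  clear he
  induction n with
  | zero => simpa using hd
  | succ n ih =>
    rw [pow_succ', Equiv.Perm.mul_apply]
    exact hF _ ih

lemma rot_apply_ne (M : G.SurfaceEmbedding) (hreg : G.IsRegularOfDegree 3) (d : G.Dart) :
    M.rot d ≠ d := by
  intro h
  have := M.three_le_card_of_rot_closed hreg {d} (Finset.mem_singleton_self d) (by simpa using h)
  simp at this

lemma rot_rot_apply_ne (M : G.SurfaceEmbedding) (hreg : G.IsRegularOfDegree 3) (d : G.Dart) :
    M.rot (M.rot d) ≠ d := by
  classical
  intro h
  have := M.three_le_card_of_rot_closed hreg {d, M.rot d} (d := d) (by simp) (by simp [h])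
  have := Finset.card_le_two (a := d) (b := M.rot d)
  omega

lemma eq_of_fst_eq (M : G.SurfaceEmbedding) (hreg : G.IsRegularOfDegree 3) {d e : G.Dart}
    (h : e.fst = d.fst) : e = d ∨ e = M.rot d ∨ e = M.rot (M.rot d) := by
  classical
  have hcard := G.dart_fst_fiber_card_eq_degree d.fst
  rw [hreg.degree_eq] at hcard
  have hsub : {d, M.rot d, M.rot (M.rot d)} ⊆
      (Finset.univ.filter fun e : G.Dart => e.fst = d.fst) := by
    intro e he
    simp only [Finset.mem_insert, Finset.mem_singleton] at he
    rcases he with rfl | rfl | rfl <;> simp [M.rot_fst]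
  have heq := Finset.eq_of_subset_of_card_le hsub (by
    rw [hcard, Finset.card_eq_three.2 ⟨_, _, _, (M.rot_apply_ne hreg d).symm,
      (M.rot_rot_apply_ne hreg d).symm, (M.rot_apply_ne hreg _).symm, rfl⟩])
  have he : e ∈ (Finset.univ.filter fun e : G.Dart => e.fst = d.fst) := by simp [h]
  rw [← heq] at he
  simpa using he

lemma rot_pow_three (M : G.SurfaceEmbedding) (hreg : G.IsRegularOfDegree 3) : M.rot ^ 3 = 1 := by
  ext1 d
  change M.rot (M.rot (M.rot d)) = d
  rcases M.eq_of_fst_eq hreg (d := d) (e := M.rot (M.rot (M.rot d))) (by simp [M.rot_fst]) with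
    h | h | h
  · exact h
  · exact absurd (M.rot.injective h) (M.rot_rot_apply_ne hreg d)
  · exact absurd h (M.rot_apply_ne hreg _)

lemma rot_zpow_apply_ne (M : G.SurfaceEmbedding) (hreg : G.IsRegularOfDegree 3) (σ : ℤˣ)
    (d : G.Dart) : (M.rot ^ (σ : ℤ)) d ≠ d := by
  rcases Int.units_eq_one_or σ with rfl | rfl
  · simpa using M.rot_apply_ne hreg d
  · intro h
    rw [Units.val_neg, Units.val_one, zpow_neg_one, Equiv.Perm.inv_eq_iff_eq] at h
    exact M.rot_apply_ne hreg d h.symm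

lemma exists_rot_zpow_eq (M : G.SurfaceEmbedding) (hreg : G.IsRegularOfDegree 3) {d e : G.Dart}
    (h : e.fst = d.fst) (hne : e ≠ d) : ∃ σ : ℤˣ, (M.rot ^ (σ : ℤ)) d = e := by
  rcases M.eq_of_fst_eq hreg h with h | h | h
  · exact absurd h hne
  · exact ⟨1, by simp [h]⟩
  · refine ⟨-1, ?_⟩
    rw [Units.val_neg, Units.val_one, zpow_neg_one, Equiv.Perm.inv_eq_iff_eq, h]
    exact (congrArg (fun f : Equiv.Perm G.Dart => f d) (M.rot_pow_three hreg)).symm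

/-- Facial walks never backtrack, because neither the rotation nor its inverse fixes a dart at a
vertex of degree three. -/
lemma faceStep_snd_ne (M : G.SurfaceEmbedding) (hreg : G.IsRegularOfDegree 3)
    (x : G.Dart × ℤˣ) : (M.faceStep x).1.snd ≠ x.1.fst := by
  intro h
  refine M.rot_zpow_apply_ne hreg (x.2 * M.dartSign x.1) x.1.symm ?_
  exact Dart.ext _ _ (Prod.ext (M.faceStep_fst x) h)

/-- In a cubic graph embedded with hexagonal faces, every path with two edges lies on a hexagon. -/
theorem AllFacesHexagons.pathsLieOnHexagons {M : G.SurfaceEmbedding} (hM : M.AllFacesHexagons)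
    (hreg : G.IsRegularOfDegree 3) : G.PathsLieOnHexagons := by
  intro a b c hab hbc hac
  obtain ⟨σ, hσ⟩ := M.exists_rot_zpow_eq hreg (d := ⟨(b, a), hab.symm⟩) (e := ⟨(b, c), hbc⟩) rfl
    (fun h => hac (congrArg (fun d : G.Dart => d.snd) h).symm)
  let d₀ : G.Dart := ⟨(a, b), hab⟩
  -- The starting sign is chosen so that after crossing `ab` it becomes `σ`, which turns the walk
  -- towards `c`.
  let x₀ : G.Dart × ℤˣ := (d₀, σ * M.dartSign d₀)
  let x : ℕ → G.Dart × ℤˣ := fun n => M.faceStep^[n] x₀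
  have hx : ∀ n, x (n + 1) = M.faceStep (x n) := fun n => Function.iterate_succ_apply' _ _ _
  have hx₁ : (x 1).1 = ⟨(b, c), hbc⟩ := by
    rw [hx, ← hσ]
    change (M.rot ^ ((σ * M.dartSign d₀ * M.dartSign d₀ : ℤˣ) : ℤ)) d₀.symm = _
    rw [mul_assoc, Int.units_mul_self, mul_one]
    rfl
  have hx₆ : (x 6).1 = d₀ := by
    have : x 6 = x₀ := by
      have h := Function.iterate_minimalPeriod (f := M.faceStep) (x := x₀)
      rwa [hM x₀] at h
    rw [this]
  have hfst : ∀ n, (x (n + 1)).1.fst = (x n).1.snd := fun n => by rw [hx, M.faceStep_fst]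
  have hsnd : ∀ n, (x (n + 2)).1.snd ≠ (x n).1.snd := fun n => by
    rw [← hfst n, hx (n + 1)]
    exact M.faceStep_snd_ne hreg _
  have hadj : ∀ n, G.Adj (x n).1.snd (x (n + 1)).1.snd := fun n => by
    rw [← hfst]
    exact (x (n + 1)).1.adj
  have h0 : (x 0).1.snd = b := rfl
  have h1 : (x 1).1.snd = c := by rw [hx₁]
  have h5 : (x 5).1.snd = a := by rw [← hfst 5, hx₆]
  have h6 : (x 6).1.snd = b := by rw [hx₆]
  refine ⟨(x 2).1.snd, (x 3).1.snd, (x 4).1.snd, h1 ▸ hadj 1, hadj 2, hadj 3, h5 ▸ hadj 4,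
    h0 ▸ hsnd 0, h1 ▸ hsnd 1, (hsnd 2).symm, h5 ▸ (hsnd 3).symm, h6 ▸ (hsnd 4).symm⟩

end SimpleGraph.SurfaceEmbedding

/-! ### Relations in the triangle group (2,3,6). -/

section HexagonalGroup

/-!
Two elements `c` and `s` of a group with `c ^ 6 = s ^ 2 = (c * s) ^ 3 = 1` behave as the rotation
about the centre of a hexagon and the half-turn about the midpoint of one of its sides in the
hexagonal tiling. Then `c ^ 3 * s` and its conjugates are the translations.
-/

variable {Γ : Type*} [Group Γ] {c s : Γ}

/-- The translation with given coordinates in the rotation group of the hexagonal tiling. -/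
def hexTranslation (c s : Γ) (m n : ℤ) : Γ := (c ^ 3 * s) ^ m * (c * (c ^ 3 * s) * c⁻¹) ^ n

lemma hex_mul_inv_mul (hs : s * s = 1) (hcs : (c * s) ^ 3 = 1) : s * c⁻¹ * s = c * s * c := by
  have hs' : s⁻¹ = s := inv_eq_of_mul_eq_one_left hs
  have h : s * c * s * (c * s * c) = 1 := by
    have : c * (s * c * s * (c * s * c)) * c⁻¹ = (c * s) ^ 3 := by
      simp only [pow_succ, pow_zero, one_mul]
      group
    rw [hcs] at this
    rw [← mul_left_cancel_iff (a := c), ← mul_right_cancel_iff (a := c⁻¹), this]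
    simp
  have := inv_eq_of_mul_eq_one_right h
  rw [← this]
  simp [mul_assoc, hs']

lemma hex_pow_five (hc : c ^ 6 = 1) : c ^ 5 = c⁻¹ := by
  rw [eq_inv_iff_mul_eq_one, ← pow_succ]
  exact hc

lemma hex_pow_three_inv (hc : c ^ 6 = 1) : (c ^ 3)⁻¹ = c ^ 3 := by
  rw [inv_eq_iff_mul_eq_one, ← pow_add]
  exact hc

/-- This is `ω² = ω - 1` for `ω = exp(iπ/3)`, written multiplicatively for a translation and its
conjugates under the rotation `c`. -/
lemma hex_conj_conj (hc : c ^ 6 = 1) (hs : s * s = 1) (hcs : (c * s) ^ 3 = 1) :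
    c * (c * (c ^ 3 * s) * c⁻¹) * c⁻¹ = (c ^ 3 * s)⁻¹ * (c * (c ^ 3 * s) * c⁻¹) := by
  rw [eq_inv_mul_iff_mul_eq]
  calc c ^ 3 * s * (c * (c * (c ^ 3 * s) * c⁻¹) * c⁻¹)
      = c ^ 3 * (s * c ^ 5 * s) * c⁻¹ * c⁻¹ := by group
    _ = c ^ 3 * (c * s * c) * c⁻¹ * c⁻¹ := by rw [hex_pow_five hc, hex_mul_inv_mul hs hcs]
    _ = _ := by group

lemma hex_commute (hc : c ^ 6 = 1) (hs : s * s = 1) (hcs : (c * s) ^ 3 = 1) :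
    Commute (c ^ 3 * s) (c * (c ^ 3 * s) * c⁻¹) := by
  have h := hex_mul_inv_mul hs hcs
  have h4 : c ^ 4 = c⁻¹ * c⁻¹ := by
    rw [← hex_pow_five hc]
    calc c ^ 4 = c ^ 6 * c ^ 4 := by rw [hc, one_mul]
      _ = _ := by group
  calc c ^ 3 * s * (c * (c ^ 3 * s) * c⁻¹) = c ^ 3 * (s * c ^ 4 * s) * c⁻¹ := by group
    _ = c ^ 3 * ((s * c⁻¹ * s) * (s * c⁻¹ * s)) * c⁻¹ := by
      rw [h4]
      congr 2
      calc s * (c⁻¹ * c⁻¹) * s = s * c⁻¹ * 1 * c⁻¹ * s := by group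
        _ = _ := by
          rw [← hs]
          group
    _ = c * (c ^ 3 * s) * c⁻¹ * (c ^ 3 * s) := by
      rw [h]
      simp only [pow_succ, pow_zero, one_mul, mul_assoc, mul_inv_cancel, mul_one,
        inv_mul_cancel_left]

lemma hexTranslation_mul (hc : c ^ 6 = 1) (hs : s * s = 1) (hcs : (c * s) ^ 3 = 1)
    (m n m' n' : ℤ) : hexTranslation c s m n * hexTranslation c s m' n' =
      hexTranslation c s (m + m') (n + n') := by
  have h := (hex_commute hc hs hcs).zpow_zpow m' n
  simp only [hexTranslation, zpow_add]
  calc _ = (c ^ 3 * s) ^ m * ((c * (c ^ 3 * s) * c⁻¹) ^ n * (c ^ 3 * s) ^ m') *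
        (c * (c ^ 3 * s) * c⁻¹) ^ n' := by simp only [mul_assoc]
    _ = _ := by
      rw [← h.eq]
      simp only [mul_assoc]

lemma hexTranslation_zero : hexTranslation c s 0 0 = 1 := by simp [hexTranslation]

/-- In the basis `1, ω`, multiplication by `ω` sends `(m, n)` to `(-n, m + n)`. Powers of `c` can
thus be moved past translations. -/
lemma mul_hexTranslation (hc : c ^ 6 = 1) (hs : s * s = 1) (hcs : (c * s) ^ 3 = 1) (m n : ℤ) :
    c * hexTranslation c s m n = hexTranslation c s (-n) (m + n) * c := by
  have hcomm := hex_commute hc hs hcs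
  rw [← mul_inv_eq_iff_eq_mul]
  calc c * hexTranslation c s m n * c⁻¹ = (c * (c ^ 3 * s) ^ m * c⁻¹) *
        (c * (c * (c ^ 3 * s) * c⁻¹) ^ n * c⁻¹) := by
        simp only [hexTranslation]
        group
    _ = (c * (c ^ 3 * s) * c⁻¹) ^ m * ((c ^ 3 * s)⁻¹ * (c * (c ^ 3 * s) * c⁻¹)) ^ n := by
        rw [← conj_zpow, ← conj_zpow (a := c), hex_conj_conj hc hs hcs]
    _ = hexTranslation c s 0 m * hexTranslation c s (-n) n := by
        rw [hcomm.inv_left.mul_zpow, hexTranslation, hexTranslation, zpow_zero, one_mul, inv_zpow,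
          zpow_neg]
    _ = hexTranslation c s (-n) (m + n) := by rw [hexTranslation_mul hc hs hcs, zero_add]

lemma pow_three_mul_hexTranslation (hc : c ^ 6 = 1) (hs : s * s = 1) (hcs : (c * s) ^ 3 = 1)
    (m n : ℤ) : c ^ 3 * hexTranslation c s m n = hexTranslation c s (-m) (-n) * c ^ 3 := by
  have h := mul_hexTranslation hc hs hcs
  calc c ^ 3 * hexTranslation c s m n = c * (c * (c * hexTranslation c s m n)) := by
        simp only [pow_succ, pow_zero, one_mul, mul_assoc]
    _ = hexTranslation c s (-(-n + (m + n))) (-(m + n) + (-n + (m + n))) * (c * c * c) := by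
        rw [h, ← mul_assoc c (hexTranslation _ _ _ _), h, mul_assoc _ c c,
          ← mul_assoc c (hexTranslation _ _ _ _), h]
        simp only [mul_assoc]
    _ = _ := by
        congr 1
        · congr 1 <;> ring
        · simp only [pow_succ, pow_zero, one_mul]

lemma eq_pow_three_mul_hexTranslation (hc : c ^ 6 = 1) : s = c ^ 3 * hexTranslation c s 1 0 := by
  simp only [hexTranslation, zpow_one, zpow_zero, mul_one, ← mul_assoc, ← pow_add]
  rw [hc, one_mul]

end HexagonalGroup

/-! ### Rotations by odd multiples of `π / 3` have no fixed points. -/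

section HexagonalAction

variable {X : Type*} {c s : Equiv.Perm X}

/-- A rotation of the hexagonal tiling by an odd multiple of the angle `π / 3` has no fixed point
if the rotations about centres of hexagons and midpoints of sides have none. -/
theorem hexTranslation_mul_zpow_apply_ne (hc : c ^ 6 = 1) (hs : s * s = 1)
    (hcs : (c * s) ^ 3 = 1) (hfc : ∀ x, c x ≠ x) (hfc3 : ∀ x, (c ^ 3) x ≠ x)
    (hfs : ∀ x, s x ≠ x) (m n : ℤ) {k : ℤ} (hk : Odd k) (x : X) :
    (hexTranslation c s m n * c ^ k) x ≠ x := by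
  have hT := hexTranslation_mul hc hs hcs
  have h1 : ∀ (m n : ℤ) x, (hexTranslation c s m n * c) x ≠ x := by
    intro m n x hx
    -- The vector `(n, -m - n)` solves the linear equation saying that conjugation by this
    -- translation turns the given rotation into `c`.
    refine hfc (hexTranslation c s n (-m - n) x) ?_
    have : c * hexTranslation c s n (-m - n) =
        hexTranslation c s n (-m - n) * (hexTranslation c s m n * c) := by
      rw [mul_hexTranslation hc hs hcs, ← mul_assoc, hT]
      congr 2 <;> ring
    rw [← Equiv.Perm.mul_apply, this, Equiv.Perm.mul_apply, hx]
  have hconj : ∀ (g p : Equiv.Perm X), g = p * s * p⁻¹ → ∀ x, g x ≠ x := by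
    rintro g p rfl x hx
    refine hfs (p⁻¹ x) ?_
    rw [Equiv.Perm.eq_inv_iff_eq]
    exact hx
  have h3 : ∀ (m n : ℤ) x, (hexTranslation c s m n * c ^ 3) x ≠ x := by
    intro m n x hx
    -- Conjugating a half-turn by a translation changes its vector by twice that translation, so
    -- only the parities of `m` and `n` matter. The class `(0, 0)` is represented by `c ^ 3`, the
    -- other three by conjugates of `s`.
    have hred : ∀ i j e f : ℤ, m = e + 2 * i → n = f + 2 * j →
        (hexTranslation c s e f * c ^ 3) (hexTranslation c s (-i) (-j) x) =
          hexTranslation c s (-i) (-j) x := by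
      rintro i j e f rfl rfl
      have : hexTranslation c s e f * c ^ 3 * hexTranslation c s (-i) (-j) =
          hexTranslation c s (-i) (-j) *
            (hexTranslation c s (e + 2 * i) (f + 2 * j) * c ^ 3) := by
        rw [mul_assoc, pow_three_mul_hexTranslation hc hs hcs, ← mul_assoc, ← mul_assoc, hT, hT]
        congr 2 <;> ring
      rw [← Equiv.Perm.mul_apply, this, Equiv.Perm.mul_apply, hx]
    have hc2 : c ^ 2 = (c ^ 4)⁻¹ := by
      rw [eq_inv_iff_mul_eq_one, ← pow_add]
      exact hc
    have hc1 : c = (c ^ 5)⁻¹ := by rw [hex_pow_five hc, inv_inv]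
    rcases Int.even_or_odd' m with ⟨i, hi | hi⟩ <;> rcases Int.even_or_odd' n with ⟨j, hj | hj⟩
    · have h := hred i j 0 0 (by omega) (by omega)
      rw [hexTranslation_zero, one_mul] at h
      exact hfc3 _ h
    · refine hconj _ (c ^ 4) ?_ _ (hred i j 0 1 (by omega) (by omega))
      rw [← hc2]
      simp only [hexTranslation]
      group
    · refine hconj _ (c ^ 3) ?_ _ (hred i j 1 0 (by omega) (by omega))
      rw [hex_pow_three_inv hc]
      simp only [hexTranslation]
      group
    -- The odd-odd class is represented by `(-1, 1)`, as `hex_conj_conj` exhibits this translation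
    -- as a conjugate.
    · refine hconj _ (c ^ 5) ?_ _ (hred (i + 1) j (-1) 1 (by omega) (by omega))
      rw [← hc1, hexTranslation, zpow_neg_one, zpow_one, ← hex_conj_conj hc hs hcs]
      group
  have hk6 : c ^ k = c ^ (k % 6) := by
    conv_lhs => rw [← Int.emod_add_mul_ediv k 6]
    rw [zpow_add, zpow_mul]
    have : c ^ (6 : ℤ) = 1 := by exact_mod_cast hc
    rw [this, one_zpow, mul_one]
  have hcases : k % 6 = 1 ∨ k % 6 = 3 ∨ k % 6 = 5 := by
    obtain ⟨j, rfl⟩ := hk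
    omega
  rw [hk6]
  rcases hcases with h | h | h <;> rw [h]
  · simpa using h1 m n x
  · exact_mod_cast h3 m n x
  · have h5 : c ^ (5 : ℤ) = c⁻¹ := by exact_mod_cast hex_pow_five hc
    rw [h5]
    intro hx
    -- The inverse of a rotation with exponent `-1` has exponent `1` and the same fixed points.
    refine h1 n (-m - n) x ?_
    have : hexTranslation c s n (-m - n) * c * (hexTranslation c s m n * c⁻¹) = 1 := by
      rw [mul_assoc, ← mul_assoc c, mul_hexTranslation hc hs hcs, ← mul_assoc, ← mul_assoc, hT]
      rw [mul_assoc, mul_inv_cancel, mul_one, ← hexTranslation_zero (c := c) (s := s)]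
      congr 1 <;> ring
    conv_lhs => rw [← hx]
    rw [← Equiv.Perm.mul_apply, this, Equiv.Perm.one_apply]

end HexagonalAction

/-! ### Direction parity of darts and bipartiteness of orientable embeddings. -/

namespace SimpleGraph

/-- `d` arises from `d₀` by a rotation by the angle `k * π / 3` of the hexagonal tiling. -/
def HexRotated {X : Type*} (c s : Equiv.Perm X) (d₀ d : X) (k : ℤ) : Prop :=
  ∃ m n : ℤ, d = (hexTranslation c s m n * c ^ k) d₀

namespace HexRotated

variable {X : Type*} {c s : Equiv.Perm X} {d₀ d : X} {k l : ℤ}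

lemma refl : HexRotated c s d₀ d₀ 0 := ⟨0, 0, by simp [hexTranslation_zero]⟩

lemma apply_left (hc : c ^ 6 = 1) (hs : s * s = 1) (hcs : (c * s) ^ 3 = 1)
    (h : HexRotated c s d₀ d k) : HexRotated c s d₀ (c d) (k + 1) := by
  obtain ⟨m, n, rfl⟩ := h
  refine ⟨-n, m + n, ?_⟩
  rw [← Equiv.Perm.mul_apply, ← mul_assoc, mul_hexTranslation hc hs hcs, mul_assoc,
    ← zpow_one_add, add_comm 1 k]

/-- The half-turn `s` is `c ^ 3` times a translation, so it adds three to the exponent. -/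
lemma apply_right (hc : c ^ 6 = 1) (hs : s * s = 1) (hcs : (c * s) ^ 3 = 1)
    (h : HexRotated c s d₀ d k) : HexRotated c s d₀ (s d) (k + 3) := by
  obtain ⟨m, n, rfl⟩ := h
  refine ⟨-(1 + m), -(0 + n), ?_⟩
  rw [← Equiv.Perm.mul_apply]
  have h : s * hexTranslation c s m n = hexTranslation c s (-(1 + m)) (-(0 + n)) * c ^ 3 := by
    rw [← pow_three_mul_hexTranslation hc hs hcs, ← hexTranslation_mul hc hs hcs, ← mul_assoc,
      ← eq_pow_three_mul_hexTranslation hc]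
  rw [← mul_assoc, h, add_comm k, zpow_add, mul_assoc]
  rfl

/-- Two descriptions of one dart yield a translation times `c ^ (k - l)` that fixes `(c ^ l) d₀`, so
`k - l` cannot be odd. -/
lemma even_sub (hc : c ^ 6 = 1) (hs : s * s = 1)
    (hcs : (c * s) ^ 3 = 1) (hfc : ∀ x, c x ≠ x) (hfc3 : ∀ x, (c ^ 3) x ≠ x)
    (hfs : ∀ x, s x ≠ x) (h : HexRotated c s d₀ d k) (h' : HexRotated c s d₀ d l) :
    Even (k - l) := by
  rw [← Int.not_odd_iff_even]
  intro hodd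
  obtain ⟨m, n, rfl⟩ := h
  obtain ⟨m', n', h⟩ := h'
  refine hexTranslation_mul_zpow_apply_ne hc hs hcs hfc hfc3 hfs (-m' + m) (-n' + n) hodd
    ((c ^ l) d₀) ?_
  have h2 := congrArg (fun x => hexTranslation c s (-m') (-n') x) h
  rw [← Equiv.Perm.mul_apply, ← Equiv.Perm.mul_apply, ← mul_assoc, ← mul_assoc,
    hexTranslation_mul hc hs hcs, hexTranslation_mul hc hs hcs,
    neg_add_cancel, neg_add_cancel, hexTranslation_zero, one_mul] at h2
  rw [← Equiv.Perm.mul_apply, mul_assoc, ← zpow_add, sub_add_cancel, h2]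

end HexRotated

namespace SurfaceEmbedding

section Oriented

variable {V : Type*} {G : SimpleGraph V}

/-- The rotation with respect to new local orientations. -/
def reorientedRot (M : G.SurfaceEmbedding) (ε : V → ℤˣ) : Equiv.Perm G.Dart where
  toFun d := (M.rot ^ (ε d.fst : ℤ)) d
  invFun d := (M.rot ^ (ε d.fst : ℤ))⁻¹ d
  left_inv d := by
    dsimp only
    rw [M.rot_zpow_fst]
    exact Equiv.symm_apply_apply _ d
  right_inv d := by
    have h := M.rot_zpow_fst (-(ε d.fst)) d
    rw [Units.val_neg, zpow_neg] at h
    dsimp only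
    rw [h]
    exact Equiv.apply_symm_apply _ d

lemma reorientedRot_fst (M : G.SurfaceEmbedding) (ε : V → ℤˣ) (d : G.Dart) :
    (M.reorientedRot ε d).fst = d.fst := M.rot_zpow_fst _ _

/-- The permutation of the darts that reverses each dart. -/
def dartReversal (G : SimpleGraph V) : Equiv.Perm G.Dart := Dart.symm_involutive.toPerm

/-- On states whose sign agrees with `ε`, face tracing is the iteration of a single permutation of
the darts: reverse, then rotate. -/
lemma iterate_faceStep (M : G.SurfaceEmbedding) {ε : V → ℤˣ}
    (hε : ∀ d : G.Dart, M.dartSign d = ε d.fst * ε d.snd) (n : ℕ) (d : G.Dart) :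
    M.faceStep^[n] (d, ε d.fst) = (((M.reorientedRot ε * dartReversal G) ^ n) d,
      ε (((M.reorientedRot ε * dartReversal G) ^ n) d).fst) := by
  have hstep : ∀ d : G.Dart, M.faceStep (d, ε d.fst) =
      ((M.reorientedRot ε * dartReversal G) d,
        ε ((M.reorientedRot ε * dartReversal G) d).fst) := by
    intro d
    have h : ε d.fst * M.dartSign d = ε d.snd := by
      rw [hε, ← mul_assoc, Int.units_mul_self, one_mul]
    refine Prod.ext ?_ ?_
    · change (M.rot ^ ((ε d.fst * M.dartSign d : ℤˣ) : ℤ)) d.symm = _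
      rw [h]
      rfl
    · change ε d.fst * M.dartSign d = ε (M.reorientedRot ε d.symm).fst
      rw [h, M.reorientedRot_fst]
      rfl
  induction n with
  | zero => rfl
  | succ n ih =>
    rw [Function.iterate_succ_apply', ih, hstep, pow_succ']
    rfl

end Oriented

variable {V : Type*} [Fintype V] {G : SimpleGraph V} [DecidableRel G.Adj]

/-- A connected cubic graph embedded with hexagonal faces in an orientable surface is bipartite. -/
theorem AllFacesHexagons.isBipartite {M : G.SurfaceEmbedding} (hM : M.AllFacesHexagons)
    (hconn : G.Connected) (hreg : G.IsRegularOfDegree 3) (hor : M.IsOrientable) :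
    G.IsBipartite := by
  classical
  obtain ⟨ε, hε⟩ := hor
  set r := M.reorientedRot ε with hr
  set s := dartReversal G with hsdef
  set c := r * s with hcdef
  have hiter := M.iterate_faceStep hε
  rw [← hr, ← hsdef, ← hcdef] at hiter
  have hss : ∀ d, s (s d) = d := fun d => d.symm_symm
  have hs : s * s = 1 := Equiv.ext hss
  have hr3 : r ^ 3 = 1 := by
    refine Equiv.ext fun d => ?_
    have hrd : ∀ e : G.Dart, e.fst = d.fst → r e = (M.rot ^ (ε d.fst : ℤ)) e := by
      intro e he
      rw [← he]
      rfl
    change r (r (r d)) = d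
    have h1 := M.reorientedRot_fst ε
    rw [hrd (r (r d)) (by rw [h1, h1]), hrd (r d) (h1 d), hrd d rfl, ← Equiv.Perm.mul_apply,
      ← Equiv.Perm.mul_apply, ← zpow_add, ← zpow_add]
    have : (ε d.fst : ℤ) + ε d.fst + ε d.fst = 3 * ε d.fst := by ring
    have h3 : M.rot ^ (3 : ℤ) = 1 := by exact_mod_cast M.rot_pow_three hreg
    rw [this, zpow_mul, h3, one_zpow, Equiv.Perm.one_apply]
  have hcsr : c * s = r := by rw [hcdef, mul_assoc, hs, mul_one]
  have hcs : (c * s) ^ 3 = 1 := by rw [hcsr, hr3]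
  have hc : c ^ 6 = 1 := by
    refine Equiv.ext fun d => ?_
    have h := Function.iterate_minimalPeriod (f := M.faceStep) (x := (d, ε d.fst))
    rw [hM, hiter] at h
    exact congrArg Prod.fst h
  -- The minimal period of a facial walk is exactly six, so no smaller positive power of `c` fixes a
  -- dart.
  have hfix : ∀ n, 0 < n → n < 6 → ∀ d, (c ^ n) d ≠ d := by
    intro n hn hn6 d hd
    have h : M.faceStep^[n] (d, ε d.fst) = (d, ε d.fst) := by rw [hiter, hd]
    have := Function.IsPeriodicPt.minimalPeriod_le hn h
    rw [hM] at this
    omega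
  have hfc : ∀ d, c d ≠ d := by simpa using hfix 1 (by norm_num) (by norm_num)
  have hfc3 := hfix 3 (by norm_num) (by norm_num)
  have hfs : ∀ d, s d ≠ d := fun d => d.symm_ne
  obtain ⟨v₀⟩ := hconn.nonempty
  obtain ⟨w₀, _, _, -, -, -, hw₀⟩ := hreg.exists_neighbors v₀
  let d₀ : G.Dart := ⟨(v₀, w₀), (hw₀ w₀).2 (Or.inl rfl)⟩
  -- Since `r = c * s`, turning at a vertex adds `3 + 1 = 4`, an even number; this keeps the parity
  -- constant around a vertex.
  have hrot : ∀ {d k}, HexRotated c s d₀ d k → HexRotated c s d₀ (r d) (k + 4) := by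
    intro d k h
    have h' := (h.apply_right hc hs hcs).apply_left hc hs hcs
    rw [← Equiv.Perm.mul_apply, hcsr, add_assoc] at h'
    exact h'
  have hsame : ∀ {d e : G.Dart} {k}, e.fst = d.fst → HexRotated c s d₀ d k →
      ∃ l, HexRotated c s d₀ e l ∧ Even (l - k) := by
    intro d e k he h
    have hrd : ∀ e : G.Dart, e.fst = d.fst → r e = (M.rot ^ (ε d.fst : ℤ)) e := by
      intro e he
      rw [← he]
      rfl
    have h2 : r (r d) = (M.rot ^ (ε d.fst : ℤ)) ((M.rot ^ (ε d.fst : ℤ)) d) := by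
      rw [hrd (r d) (M.reorientedRot_fst ε d), hrd d rfl]
    -- Where `ε` is `-1` the reoriented rotation is the inverse of `M.rot`, which only swaps the
    -- last two alternatives.
    have hrr : e = d ∨ e = r d ∨ e = r (r d) := by
      rw [h2, hrd d rfl]
      have h4 : M.rot (M.rot d) = M.rot⁻¹ d := by
        rw [Equiv.Perm.eq_inv_iff_eq]
        exact congrArg (fun f : Equiv.Perm G.Dart => f d) (M.rot_pow_three hreg)
      have h5 : M.rot d = M.rot⁻¹ (M.rot⁻¹ d) := by
        rw [← h4]
        exact (M.rot.symm_apply_apply _).symm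
      rcases M.eq_of_fst_eq hreg he with h | h | h
      · exact Or.inl h
      · rcases Int.units_eq_one_or (ε d.fst) with hε | hε <;> rw [hε]
        · exact Or.inr (Or.inl (by simpa using h))
        · exact Or.inr (Or.inr (by rw [h, h5, Units.val_neg, Units.val_one, zpow_neg_one]))
      · rcases Int.units_eq_one_or (ε d.fst) with hε | hε <;> rw [hε]
        · exact Or.inr (Or.inr (by simpa using h))
        · exact Or.inr (Or.inl (by rw [h, h4, Units.val_neg, Units.val_one, zpow_neg_one]))
    rcases hrr with rfl | rfl | rfl
    · exact ⟨k, h, by simp⟩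
    · exact ⟨k + 4, hrot h, by simp; decide⟩
    · exact ⟨k + 4 + 4, hrot (hrot h), ⟨4, by ring⟩⟩
  have hreach : ∀ d, ∃ k, HexRotated c s d₀ d k := by
    have huniv := hconn.eq_univ_of_adj_closed
      (s := {v | ∀ d : G.Dart, d.fst = v → ∃ k, HexRotated c s d₀ d k})
      ⟨v₀, fun d hd => (hsame (d := d₀) hd HexRotated.refl).imp fun _ h => h.1⟩ (by
        intro x hx y hxy d hd
        obtain ⟨k, hk⟩ := hx ⟨(x, y), hxy⟩ rfl
        exact (hsame hd (hk.apply_right hc hs hcs)).imp fun _ h => h.1)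
    intro d
    have : d.fst ∈ {v | ∀ d : G.Dart, d.fst = v → ∃ k, HexRotated c s d₀ d k} :=
      huniv ▸ Set.mem_univ d.fst
    exact this d rfl
  choose κ hκ using hreach
  have hpar : ∀ {d k}, HexRotated c s d₀ d k → Even (k - κ d) := fun h =>
    h.even_sub hc hs hcs hfc hfc3 hfs (hκ _)
  have hκsame : ∀ {d e : G.Dart}, e.fst = d.fst → Even (κ e - κ d) := by
    intro d e he
    obtain ⟨l, hl, hlk⟩ := hsame he (hκ d)
    have := hlk.sub (hpar hl)
    rwa [sub_sub_sub_cancel_left] at this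
  have hcol : ∀ d : G.Dart, (∃ e : G.Dart, e.fst = d.fst ∧ Even (κ e)) ↔ Even (κ d) := by
    intro d
    refine ⟨?_, fun h => ⟨d, rfl, h⟩⟩
    rintro ⟨e, he, h⟩
    have := h.sub (hκsame he)
    rwa [sub_sub_cancel] at this
  -- Colours are propositions, of which there are two. Crossing an edge adds three to the exponent,
  -- so adjacent vertices get different parities.
  have hcoloring : G.Coloring Prop := Coloring.mk
    (fun v => ∃ e : G.Dart, e.fst = v ∧ Even (κ e)) (by
      intro v w hvw heq
      have h1 := hcol ⟨(v, w), hvw⟩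
      have h2 := hcol ⟨(w, v), hvw.symm⟩
      have h3 := hpar ((hκ ⟨(v, w), hvw⟩).apply_right hc hs hcs)
      change Even (κ ⟨(v, w), hvw⟩ + 3 - κ ⟨(w, v), hvw.symm⟩) at h3
      change (∃ e : G.Dart, e.fst = v ∧ Even (κ e)) ↔ _ at h1
      change (∃ e : G.Dart, e.fst = w ∧ Even (κ e)) ↔ _ at h2
      rw [heq] at h1
      have h4 := h1.symm.trans h2
      rw [Int.even_iff, Int.even_iff] at h4
      rw [Int.even_iff] at h3
      omega)
  have := hcoloring.colorable
  simpa using this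

end SurfaceEmbedding

end SimpleGraph

theorem mainTheorem7 {V : Type*} [Fintype V] (G : SimpleGraph V) [DecidableRel G.Adj]
    (hG : G.IsToroidalFullerene ∨ (G.IsKleinBottleFullerene ∧ G.IsBipartite)) :
    G.antiKekuleNumber = 4 := by
  rcases hG with ⟨hconn, hreg, M, hM, hhex⟩ | ⟨⟨hconn, hreg, M, -, hhex⟩, hbip⟩
  · exact (hhex.pathsLieOnHexagons hreg).antiKekuleNumber_eq_four hconn hreg
      (hhex.isBipartite hconn hreg hM.1)
  · exact (hhex.pathsLieOnHexagons hreg).antiKekuleNumber_eq_four hconn hreg hbip
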